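/- A BSS machine has an unbounded tape with one real number in each cell, a reading head and a writing head that move independently, finitely many states, and finitely many real constants $c_1,\dots,c_J$. In each step, depending on the current state and on the sign of the real $x$ under the reading head, it either replaces the real $y$ under the writing head by one of $x$, $y+x$, $y\cdot x$, $y-x$, $y/x$ (the last only if $x\neq 0$) or $c_j$, or moves one of the heads by one cell, or halts. On input $\vec x\in\mathbb{R}^*:=\bigcup_{n\in\mathbb{N}}\mathbb{R}^n$ of size $n$ it starts with tape contents $(n,x_1,\dots,x_n)$; if it halts with tape contents of the form $(m,y_1,\dots,y_m,\dots)$, $m\in\mathbb{N}$, its output is $(y_1,\dots,y_m)$. A BSS oracle machine with oracle $\mathbb{O}\subseteq\mathbb{R}^*$ may moreover write to a dedicated query tape and branch on whether the vector currently held by the query tape belongs to $\mathbb{O}$. A language $\mathbb{L}\subseteq\mathbb{R}^*$ is *BSS decidable relative to* $\mathbb{O}$, written $\mathbb{L}\preceq\mathbb{O}$, if some BSS oracle machine with oracle $\mathbb{O}$ computes the characteristic function of $\mathbb{L}$, i.e. halts on every input $\vec x\in\mathbb{R}^*$, with output $1$ if $\vec x\in\mathbb{L}$ and with output $0$ if $\vec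 x\notin\mathbb{L}$. Let $\mathbb{T}\subseteq\mathbb{R}=\mathbb{R}^1$ be the set of real numbers that are transcendental over $\mathbb{Q}$. For $\vec z=(z_1,\dots,z_D)\in\mathbb{R}^*$ let $$\mathbb{I}_{\vec z}:=\{\vec x\in\mathbb{R}^* : \vec x \text{ is algebraically independent over } \mathbb{Q}(z_1,\dots,z_D)\},$$ where $(x_1,\dots,x_n)$ is algebraically independent over a field $E\subseteq\mathbb{R}$ if $p(x_1,\dots,x_n)\neq0$ for every non-zero $p\in E[X_1,\dots,X_n]$. Let $\mathbb{I}:=\mathbb{I}_{()}$ be the set of real vectors algebraically independent over $\mathbb{Q}$. **Proposition.** For every fixed $\vec z\in\mathbb{R}^*$, the set $\mathbb{T}$ is BSS decidable relative to $\mathbb{I}_{\vec z}$, and $\mathbb{I}_{\vec z}$ is BSS decidable relative to $\mathbb{I}$. In formula: $\mathbb{T}\preceq\mathbb{I}_{\vec z}\preceq\mathbb{I}$. -/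

import Mathlib

namespace BSS

/-- An oracle machine has a main (input, work and output) tape and a dedicated query tape. -/
inductive TapeName
  | main
  | query
  deriving DecidableEq

/-- Operations changing the cell `y` under a writing head, where `x` is the content of the cell
under the reading head; `const j` refers to the `j`-th real constant of the machine. -/
inductive Op (J : ℕ)
  | copy
  | add
  | mul
  | sub
  | div
  | const (j : Fin J)

open Classical in
/-- The new content of the cell `y`. Division by `0` is undefined. -/
noncomputable def Op.eval {J : ℕ} (c : Fin J → ℝ) (x y : ℝ) : Op J → Option ℝ
  | .copy => some x
  | .add => some (y + x)
  | .mul => some (y * x)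
  | .sub => some (y - x)
  | .div => if x = 0 then none else some (y / x)
  | .const j => some (c j)

/-- What the finite control may do in one step; all instructions except `halt` name the
next state (`query` one for each answer of the oracle). -/
inductive Instr (Q : Type) (J : ℕ)
  | write (t : TapeName) (o : Op J) (q : Q)
  | moveRead (d : Turing.Dir) (q : Q)
  | moveWrite (t : TapeName) (d : Turing.Dir) (q : Q)
  | query (yes no : Q)
  | halt

/-- A BSS oracle machine: finitely many states, finitely many real constants, and a finite control
whose instruction depends on the state and on the sign of the real under the reading head.
An ordinary BSS machine is one that has no `query` instruction and never writes
to the query tape. -/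
structure Machine where
  Q : Type
  finQ : Finite Q
  start : Q
  J : ℕ
  c : Fin J → ℝ
  control : Q → SignType → Instr Q J

/-- A configuration: current state, contents of the two tapes, position of the
reading head (on the main tape) and of the two writing heads (one for each tape). -/
structure Config (Q : Type) where
  state : Q
  tape : TapeName → ℤ → ℝ
  rd : ℤ
  wr : TapeName → ℤ

/-- The displacement of a head. -/
def shift : Turing.Dir → ℤ
  | .left => -1
  | .right => 1

/-- The tape contents is of the form `(m, y₁, …, yₘ, …)`, starting at cell `0`,
with `v = (y₁, …, yₘ)`. -/
def Holds (t : ℤ → ℝ) (v : List ℝ) : Prop :=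
  t 0 = v.length ∧ ∀ i : Fin v.length, t ((i : ℕ) + 1) = v.get i

/-- The tape containing `(n, x₁, …, xₙ)` from cell `0` onwards, and `0` in all other cells. -/
def inputTape (x : List ℝ) (k : ℤ) : ℝ :=
  if k = 0 then x.length else if 0 < k then x.getD (k - 1).toNat 0 else 0

/-- The configuration in which the execution on input `x` starts. -/
def Machine.init (M : Machine) (x : List ℝ) : Config M.Q where
  state := M.start
  tape
    | .main => inputTape x
    | .query => fun _ => 0
  rd := 0
  wr _ := 0

/-- The instruction that is due in a configuration. -/
noncomputable def Machine.instr (M : Machine) (s : Config M.Q) : Instr M.Q M.J :=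
  M.control s.state (SignType.sign (s.tape .main s.rd))

open Classical in
/-- One step of the machine with oracle `O`. There is no next configuration after `halt`, nor
after an attempted division by zero (which does not count as a termination). -/
noncomputable def Machine.step (M : Machine) (O : Set (List ℝ)) (s : Config M.Q) :
    Option (Config M.Q) :=
  match M.instr s with
  | .write t o q =>
      (o.eval M.c (s.tape .main s.rd) (s.tape t (s.wr t))).map fun y =>
        { s with
          state := q
          tape := Function.update s.tape t (Function.update (s.tape t) (s.wr t) y) }
  | .moveRead d q => some { s with state := q, rd := s.rd + shift d }
  | .moveWrite t d q =>
      some { s with state := q, wr := Function.update s.wr t (s.wr t + shift d) }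
  | .query yes no =>
      some { s with state := if ∃ v ∈ O, Holds (s.tape .query) v then yes else no }
  | .halt => none

/-- With oracle `O` and on input `x`, the machine terminates with output `y`. -/
def Machine.Outputs (M : Machine) (O : Set (List ℝ)) (x y : List ℝ) : Prop :=
  ∃ s : Config M.Q,
    Relation.ReflTransGen (fun a b => M.step O a = some b) (M.init x) s ∧
      M.instr s = .halt ∧ Holds (s.tape .main) y

/-- The real language `L` is BSS decidable relative to the oracle `O`: some BSS oracle machine
with oracle `O` realizes the characteristic function of `L`. -/
def DecidableRelativeTo (L O : Set (List ℝ)) : Prop :=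
  ∃ M : Machine, ∀ x : List ℝ,
    (x ∈ L → M.Outputs O x [1]) ∧ (x ∉ L → M.Outputs O x [0])

/-- The set of reals transcendental over `ℚ`, as a real language (of vectors of size one). -/
def transcendentals : Set (List ℝ) :=
  {v | ∃ x : ℝ, v = [x] ∧ Transcendental ℚ x}

/-- The set of real vectors that are algebraically independent over `ℚ(z₁, …, z_D)`. -/
def independents (z : List ℝ) : Set (List ℝ) :=
  {x | AlgebraicIndependent (IntermediateField.adjoin ℚ {r : ℝ | r ∈ z}) x.get}

end BSS

namespace BSS

/-! Choose a maximal algebraically independent subfamily `b` of `z`. Since ℚ(z) is algebraic over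
ℤ[b], a vector `x` is independent over ℚ(z) iff the concatenation `b ++ x` is independent over ℚ
(`mem_independents_iff_append`). A machine with the entries of `b` among its constants can therefore
answer for `z` with one query to the oracle for the empty list (`decidableRelativeTo_append`).

For transcendence of a single real x, query x itself. If x is independent over ℚ(z), it is
transcendental. Otherwise some nonzero polynomial P over ℤ[X], in variables for `b`, vanishes at (x,
b). Fix a nonzero coefficient p ∈ ℤ[X] of P. If p(x) = 0, then x is algebraic. If p(x) ≠ 0, then x
is transcendental: for algebraic x the family `b` would stay independent over the algebraic numbers,
and P(x, b) = 0 would force p(x) = 0 (`evalAt_ne_zero`). So each pair (P, p) gives a test that is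
never wrong for any x, and some pair settles the given x (`exists_sound`).

It remains to run through all these tests. Each is a finite word over a finite alphabet of
arithmetic instructions, so there are countably many. Their concatenation in any order is encoded in
the digits of one real constant (`exists_digits`, `exists_stream`), and the machine is an
interpreter extracting and executing one digit at a time. Machines are built as structured programs
whose compilation is proved correct once (`Exec.runs`). -/

/-! ### Algebraic independence over a field generated by parameters -/

theorem mem_independents_iff (z : List ℝ) :
    ∃ b : List ℝ, AlgebraicIndependent ℤ b.get ∧ (∀ r ∈ b, r ∈ z) ∧ ∀ x : List ℝ, x ∈ independents z ↔
      AlgebraicIndependent (Algebra.adjoin ℤ (Set.range b.get)) x.get := by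
  obtain ⟨s, hs⟩ := (AlgebraicIndependent.matroid ℤ ℝ).exists_isBasis {r : ℝ | r ∈ z} (by simp)
  rw [AlgebraicIndependent.matroid_isBasis_iff] at hs
  obtain ⟨hind, hsub, halg⟩ := hs
  have hfin : s.Finite := z.finite_toSet.subset hsub
  set b := hfin.toFinset.toList with hb
  have hmem : ∀ r, r ∈ b ↔ r ∈ s := by simp [hb]
  have hrange : Set.range b.get = s := by
    ext r; rw [← hmem, List.mem_iff_get]; rfl
  have hnd : b.Nodup := Finset.nodup_toList _
  clear_value b
  have hbind : AlgebraicIndependent ℤ b.get := by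
    let f : Fin b.length → s := fun i => ⟨b.get i, (hmem _).1 (List.get_mem _ _)⟩
    have hinj : Function.Injective f := fun i j h =>
      List.nodup_iff_injective_get.1 hnd (congrArg Subtype.val h)
    exact AlgebraicIndependent.comp (x := fun i : s => (i : ℝ)) hind f hinj
  refine ⟨b, hbind, fun r hr => hsub ((hmem r).1 hr), fun x => ?_⟩
  rw [hrange]
  set A := Algebra.adjoin ℤ s
  set E := IntermediateField.adjoin ℚ {r : ℝ | r ∈ z} with hE
  -- Maximality of `s` makes the generators of `E` algebraic over ℤ[s]; field operations preserve
  -- this. Independence is unchanged along the algebraic extension `E` of `A`.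
  have hE_alg : ∀ y ∈ E, IsAlgebraic A y := by
    intro y hy
    induction hy using IntermediateField.adjoin_induction with
    | mem r hr => exact halg r hr
    | algebraMap q =>
      have : IsAlgebraic ℤ (algebraMap ℚ ℝ q) :=
        (IsFractionRing.isAlgebraic_iff ℤ ℚ ℝ).2 (isAlgebraic_algebraMap q)
      exact this.extendScalars (algebraMap ℤ A).injective_int
    | add _ _ _ _ h h' => exact h.add h'
    | inv _ _ h => exact h.inv
    | mul _ _ _ _ h h' => exact h.mul h'
  have hAE : ∀ a : A, (a : ℝ) ∈ E := by
    rintro ⟨a, ha⟩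
    have : A ≤ E.toSubalgebra.restrictScalars ℤ :=
      Algebra.adjoin_le fun r hr => IntermediateField.subset_adjoin _ _ (hsub hr)
    exact this ha
  let f : A →+* E := (algebraMap A ℝ).codRestrict E.toSubfield.toSubring hAE
  let _ : Algebra A E := f.toAlgebra
  have : IsScalarTower A E ℝ := .of_algebraMap_eq fun _ => rfl
  have : FaithfulSMul A E := (faithfulSMul_iff_algebraMap_injective A E).2 fun a a' h =>
    Subtype.ext (congrArg (fun e : E => (e : ℝ)) h)
  have : Algebra.IsAlgebraic A E := ⟨fun y => by
    rw [← isAlgebraic_algHom_iff (IsScalarTower.toAlgHom A E ℝ) Subtype.val_injective]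
    exact hE_alg y y.2⟩
  exact (Algebra.IsAlgebraic.algebraicIndependent_iff A (S := E)).symm

theorem algebraicIndependent_append_iff (b x : List ℝ) :
    AlgebraicIndependent ℤ (b ++ x).get ↔ AlgebraicIndependent ℤ b.get ∧
      AlgebraicIndependent (Algebra.adjoin ℤ (Set.range b.get)) x.get := by
  rw [← AlgebraicIndependent.sumElim_iff]
  let e : Fin x.length ⊕ Fin b.length ≃ Fin (b ++ x).length :=
    (Equiv.sumComm _ _).trans (finSumFinEquiv.trans (finCongr (by simp)))
  rw [← algebraicIndependent_equiv e]
  have : (b ++ x).get ∘ e = Sum.elim x.get b.get := by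
    funext i
    rcases i with i | i <;> simp [e]
  rw [this]

theorem mem_independents_nil_iff (x : List ℝ) :
    x ∈ independents [] ↔ AlgebraicIndependent ℤ x.get := by
  obtain ⟨b, hb, hsub, h⟩ := mem_independents_iff []
  obtain rfl : b = [] := List.eq_nil_iff_forall_not_mem.2 fun r hr => by simpa using hsub r hr
  rw [h, ← List.nil_append x, algebraicIndependent_append_iff]
  simp only [List.nil_append, hb, true_and]

/-- A polynomial in the `b`'s with coefficients in `ℤ[X]`, evaluated at `X = y`. -/
noncomputable def evalAt (b : List ℝ) (y : ℝ) :
    MvPolynomial (Fin b.length) (Polynomial ℤ) →+* ℝ :=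
  MvPolynomial.eval₂Hom (Polynomial.aeval y : Polynomial ℤ →ₐ[ℤ] ℝ).toRingHom b.get

/-- As `b` is independent, the failure must come from a nontrivial integer relation among `x` and
`b` jointly; it is regrouped so that the variable for `x` moves into the coefficients. -/
theorem exists_evalAt_eq_zero {b : List ℝ} (hb : AlgebraicIndependent ℤ b.get) {x : ℝ}
    (hx : ¬ AlgebraicIndependent (Algebra.adjoin ℤ (Set.range b.get)) [x].get) :
    ∃ P, P ≠ 0 ∧ evalAt b x P = 0 := by
  have hx : ¬ AlgebraicIndependent ℤ (fun o : Option (Fin b.length) => o.elim x b.get) := by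
    rw [hb.option_iff_transcendental]
    rwa [algebraicIndependent_unique_type_iff (ι := Fin 1)] at hx
  rw [algebraicIndependent_iff] at hx
  push Not at hx
  obtain ⟨p, hp, hp0⟩ := hx
  refine ⟨MvPolynomial.optionEquivRight ℤ _ p, (map_ne_zero_iff _ (AlgEquiv.injective _)).2 hp0, ?_⟩
  rw [← hp]
  have : (evalAt b x).comp (MvPolynomial.optionEquivRight ℤ (Fin b.length) : _ →+* _) =
      (MvPolynomial.aeval (fun o : Option (Fin b.length) => o.elim x b.get) :
        _ →ₐ[ℤ] ℝ).toRingHom := by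
    refine MvPolynomial.ringHom_ext (by simp) fun o => ?_
    cases o <;> simp [evalAt]
  exact congrArg (fun f => f p) this

/-- Independence of `b` persists over the algebraic closure of ℤ in ℝ, which contains `y`.
Specializing X to `y` thus leaves a polynomial over that ring, nonzero because of its
`α`-coefficient. -/
theorem evalAt_ne_zero {b : List ℝ} (hb : AlgebraicIndependent ℤ b.get) {y : ℝ}
    (hy : IsAlgebraic ℚ y) {P : MvPolynomial (Fin b.length) (Polynomial ℤ)} {α : Fin b.length →₀ ℕ}
    (hP : Polynomial.aeval y (P.coeff α) ≠ 0) : evalAt b y P ≠ 0 := by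
  have hy : IsAlgebraic ℤ y := (IsFractionRing.isAlgebraic_iff ℤ ℚ ℝ).2 hy
  have hb' : AlgebraicIndependent (Subalgebra.algebraicClosure ℤ ℝ) b.get :=
    hb.subalgebraAlgebraicClosure
  let y' : Subalgebra.algebraicClosure ℤ ℝ := ⟨y, hy⟩
  intro h
  have hmap := (algebraicIndependent_iff.1 hb')
    (MvPolynomial.map (Polynomial.aeval y' : Polynomial ℤ →ₐ[ℤ] _).toRingHom P) (by
      rw [← h, MvPolynomial.aeval_def, MvPolynomial.eval₂_map, evalAt, MvPolynomial.coe_eval₂Hom]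
      congr 1
      refine Polynomial.ringHom_ext (by simp) (by simp [y']))
  have := congrArg (fun Q => ((Q.coeff α : Subalgebra.algebraicClosure ℤ ℝ) : ℝ)) hmap
  simp only [MvPolynomial.coeff_map, MvPolynomial.coeff_zero] at this
  refine hP (Eq.trans ?_ this)
  exact Polynomial.aeval_algHom_apply (Subalgebra.val (Subalgebra.algebraicClosure ℤ ℝ)) y' _

theorem mem_independents_iff_append (z : List ℝ) :
    ∃ b : List ℝ, ∀ x : List ℝ, x ∈ independents z ↔ b ++ x ∈ independents [] := by
  obtain ⟨b, hb, -, h⟩ := mem_independents_iff z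
  exact ⟨b, fun x => by
    rw [h, mem_independents_nil_iff, algebraicIndependent_append_iff, and_iff_right hb]⟩

/-! ### Structured programs and their compilation to machines -/

/-- The contents of the two tapes and the positions of the three heads. -/
structure Data where
  main : ℤ → ℝ
  query : ℤ → ℝ
  rd : ℤ
  wm : ℤ
  wq : ℤ

/-- The configuration with a given state and given data. -/
def Data.config {Q : Type} (d : Data) (q : Q) : Config Q where
  state := q
  tape
    | .main => d.main
    | .query => d.query
  rd := d.rd
  wr
    | .main => d.wm
    | .query => d.wq

/-- Elementary actions: all instructions but divisions, queries and `halt`. -/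
inductive Act (J : ℕ)
  | copy (t : TapeName)
  | add (t : TapeName)
  | mul (t : TapeName)
  | sub (t : TapeName)
  | const (t : TapeName) (j : Fin J)
  | moveRead (δ : Turing.Dir)
  | moveWrite (t : TapeName) (δ : Turing.Dir)

/-- Change the cell under the writing head of the tape `t`. -/
def Data.write (d : Data) (f : ℝ → ℝ) : TapeName → Data
  | .main => { d with main := Function.update d.main d.wm (f (d.main d.wm)) }
  | .query => { d with query := Function.update d.query d.wq (f (d.query d.wq)) }

/-- The effect of an elementary action. -/
def Act.run {J : ℕ} (c : Fin J → ℝ) (d : Data) : Act J → Data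
  | .copy t => d.write (fun _ => d.main d.rd) t
  | .add t => d.write (fun y => y + d.main d.rd) t
  | .mul t => d.write (fun y => y * d.main d.rd) t
  | .sub t => d.write (fun y => y - d.main d.rd) t
  | .const t j => d.write (fun _ => c j) t
  | .moveRead δ => { d with rd := d.rd + shift δ }
  | .moveWrite .main δ => { d with wm := d.wm + shift δ }
  | .moveWrite .query δ => { d with wq := d.wq + shift δ }

/-- The machine instruction performing an elementary action. -/
def Act.instr {J : ℕ} {Q : Type} (q : Q) : Act J → Instr Q J
  | .copy t => .write t .copy q
  | .add t => .write t .add q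
  | .mul t => .write t .mul q
  | .sub t => .write t .sub q
  | .const t j => .write t (.const j) q
  | .moveRead δ => .moveRead δ q
  | .moveWrite t δ => .moveWrite t δ q

/-- Structured programs. The tests in `ite` and `loop` concern the sign of the cell under the
reading head. -/
inductive Prog (J : ℕ)
  | skip
  | act (a : Act J)
  | seq (p q : Prog J)
  | ite (t : SignType → Bool) (p q : Prog J)
  | query (p q : Prog J)
  | loop (t : SignType → Bool) (p : Prog J)

/-- The result of a test. -/
noncomputable def Data.test (d : Data) (t : SignType → Bool) : Bool :=
  t (SignType.sign (d.main d.rd))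

/-- The answer to a query. -/
def Data.Answer (O : Set (List ℝ)) (d : Data) : Prop := ∃ v ∈ O, Holds d.query v

/-- The execution of a program with oracle `O` and constants `c`. -/
inductive Exec {J : ℕ} (O : Set (List ℝ)) (c : Fin J → ℝ) : Prog J → Data → Data → Prop
  | skip (d) : Exec O c .skip d d
  | act (a d) : Exec O c (.act a) d (a.run c d)
  | seq {p q d d' d''} : Exec O c p d d' → Exec O c q d' d'' → Exec O c (.seq p q) d d''
  | iteTrue {t p q d d'} : d.test t = true → Exec O c p d d' → Exec O c (.ite t p q) d d'
  | iteFalse {t p q d d'} : d.test t = false → Exec O c q d d' → Exec O c (.ite t p q) d d'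
  | queryYes {p q d d'} : d.Answer O → Exec O c p d d' → Exec O c (.query p q) d d'
  | queryNo {p q d d'} : ¬ d.Answer O → Exec O c q d d' → Exec O c (.query p q) d d'
  | loopTrue {t p d d' d''} : d.test t = true → Exec O c p d d' → Exec O c (.loop t p) d' d'' →
      Exec O c (.loop t p) d d''
  | loopFalse {t p d} : d.test t = false → Exec O c (.loop t p) d d

/-- A machine fragment with a designated exit state. -/
structure Fragment (J : ℕ) where
  Q : Type
  finQ : Finite Q
  start : Q
  exit : Q
  control : Q → SignType → Instr Q J

open Classical in
/-- The machine that halts in the exit state. -/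
noncomputable def Fragment.machine {J : ℕ} (F : Fragment J) (c : Fin J → ℝ) : Machine where
  Q := F.Q
  finQ := F.finQ
  start := F.start
  J := J
  c := c
  control q s := if q = F.exit then .halt else F.control q s

/-- The transition relation of a fragment. -/
def Fragment.Step {J : ℕ} (F : Fragment J) (O : Set (List ℝ)) (c : Fin J → ℝ)
    (a b : F.Q × Data) : Prop :=
  (F.machine c).step O (a.2.config a.1) = some (b.2.config b.1)

/-- The fragment leads from `d`, in its start state, to `d'`, in its exit state. -/
def Fragment.Runs {J : ℕ} (F : Fragment J) (O : Set (List ℝ)) (c : Fin J → ℝ) (d d' : Data) :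
    Prop :=
  Relation.ReflTransGen (F.Step O c) (F.start, d) (F.exit, d')

/-- Rename the states of an instruction. -/
def Instr.map {Q Q' : Type} {J : ℕ} (f : Q → Q') : Instr Q J → Instr Q' J
  | .write t o q => .write t o (f q)
  | .moveRead δ q => .moveRead δ (f q)
  | .moveWrite t δ q => .moveWrite t δ (f q)
  | .query q q' => .query (f q) (f q')
  | .halt => .halt

/-- An instruction that only changes the state. -/
def Instr.goto {Q : Type} {J : ℕ} (q : Q) : Instr Q J := .query q q

variable {J : ℕ} {O : Set (List ℝ)} {c : Fin J → ℝ}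

theorem Fragment.step_act (F : Fragment J) {q q' : F.Q} {d : Data} {a : Act J} (hq : q ≠ F.exit)
    (h : F.control q (SignType.sign (d.main d.rd)) = a.instr q') :
    F.Step O c (q, d) (q', a.run c d) := by
  have : (F.machine c).instr (d.config q) = a.instr q' := by
    exact (if_neg hq).trans h
  have key : ∀ (t : TapeName) (f : ℝ → ℝ), (d.write f t).config q' =
      { d.config q with
        state := q'
        tape := Function.update (d.config q).tape t
          (Function.update ((d.config q).tape t) ((d.config q).wr t)
            (f ((d.config q).tape t ((d.config q).wr t)))) } := by
    intro t f
    cases t <;>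
    · simp only [Data.config, Data.write, Config.mk.injEq, true_and, and_true]
      funext t
      cases t <;> simp
  cases a with
  | moveWrite t δ =>
    simp only [Step, Machine.step, this, Act.instr]
    refine congrArg some ?_
    cases t <;>
    · simp only [Data.config, Act.run]
      refine (Config.mk.injEq ..).mpr ⟨rfl, rfl, rfl, ?_⟩
      funext t
      cases t <;> simp
  | moveRead δ => simp only [Step, Machine.step, this, Act.instr]; rfl
  | _ =>
    simp only [Step, Machine.step, this, Act.instr, Op.eval, Option.map_some, Act.run, key]
    rfl

theorem Fragment.step_query (F : Fragment J) {q q₁ q₂ : F.Q} {d : Data} (hq : q ≠ F.exit)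
    (h : F.control q (SignType.sign (d.main d.rd)) = .query q₁ q₂) :
    (d.Answer O → F.Step O c (q, d) (q₁, d)) ∧ (¬ d.Answer O → F.Step O c (q, d) (q₂, d)) := by
  have : (F.machine c).instr (d.config q) = .query q₁ q₂ := (if_neg hq).trans h
  simp only [Step, Machine.step, this]
  constructor <;> intro ha <;> refine congrArg some ?_ <;>
    simp only [Data.Answer] at ha <;> simp only [Data.config, ha] <;> rfl

theorem Fragment.step_goto (F : Fragment J) {q q' : F.Q} {d : Data} (hq : q ≠ F.exit)
    (h : F.control q (SignType.sign (d.main d.rd)) = .goto q') : F.Step O c (q, d) (q', d) := by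
  by_cases ha : d.Answer O
  · exact (F.step_query hq h).1 ha
  · exact (F.step_query hq h).2 ha

/-- Embeds a fragment in a larger one. The exit state is exempt from the compatibility condition: no
step of `F` leaves it, so `G` is free to continue from there. -/
theorem Fragment.Runs.map {F G : Fragment J} {d d' : Data} (h : F.Runs O c d d') (g : F.Q → G.Q)
    (hg : ∀ q, q ≠ F.exit → g q ≠ G.exit)
    (hc : ∀ q s, q ≠ F.exit → G.control (g q) s = (F.control q s).map g) :
    Relation.ReflTransGen (G.Step O c) (g F.start, d) (g F.exit, d') := by
  refine Relation.ReflTransGen.lift (fun a : F.Q × Data => ((g a.1, a.2) : G.Q × Data)) ?_ _ _ h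
  rintro ⟨q, d⟩ ⟨q', d'⟩ hs
  by_cases hq : q = F.exit
  · have : (F.machine c).instr (d.config q) = .halt := if_pos hq
    simp [Step, Machine.step, this] at hs
  · have h1 : (F.machine c).instr (d.config q) = F.control q (SignType.sign (d.main d.rd)) :=
      if_neg hq
    have h2 : (G.machine c).instr (d.config (g q)) =
        (F.control q (SignType.sign (d.main d.rd))).map g := by
      rw [← hc _ _ hq]; exact if_neg (hg q hq)
    have hconf : ∀ (s : Config F.Q), s = d'.config q' →
        ({ s with state := g s.state } : Config G.Q) = d'.config (g q') := by
      rintro s rfl; rfl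
    simp only [Step, Machine.step, h1] at hs
    simp only [Step, Machine.step, h2]
    cases hi : F.control q (SignType.sign (d.main d.rd)) with
    | halt => simp [hi] at hs
    | write t o q₁ =>
      rw [hi] at hs
      obtain ⟨y, hy, hs⟩ := Option.map_eq_some_iff.1 hs
      exact Option.map_eq_some_iff.2 ⟨y, hy, hconf _ hs⟩
    | query q₁ q₂ =>
      rw [hi] at hs
      refine congrArg some (Eq.trans ?_ (hconf _ (Option.some.inj hs)))
      refine (Config.mk.injEq ..).mpr ⟨?_, rfl, rfl, rfl⟩
      classical exact (apply_ite g (d.Answer O) q₁ q₂).symm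
    | _ =>
      rw [hi] at hs
      exact congrArg some (hconf _ (Option.some.inj hs))

/-- The fragment that performs one action. -/
def Fragment.act (a : Act J) : Fragment J :=
  ⟨Bool, inferInstance, false, true, fun _ _ => a.instr true⟩

open Classical in
/-- Sequential composition. -/
noncomputable def Fragment.seq (F G : Fragment J) : Fragment J :=
  have := F.finQ
  have := G.finQ
  { Q := F.Q ⊕ G.Q
    finQ := inferInstance
    start := .inl F.start
    exit := .inr G.exit
    control
      | .inl i, s => if i = F.exit then .goto (.inr G.start) else (F.control i s).map .inl
      | .inr i, s => (G.control i s).map .inr }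

open Classical in
/-- A choice between two fragments. -/
noncomputable def Fragment.branch (F G : Fragment J)
    (first : SignType → Instr (Option (F.Q ⊕ G.Q)) J) : Fragment J :=
  have := F.finQ
  have := G.finQ
  { Q := Option (F.Q ⊕ G.Q)
    finQ := inferInstance
    start := none
    exit := some (.inr G.exit)
    control
      | none, s => first s
      | some (.inl i), s => if i = F.exit then .goto (some (.inr G.exit))
          else (F.control i s).map (fun i => some (.inl i))
      | some (.inr i), s => (G.control i s).map (fun i => some (.inr i)) }

open Classical in
/-- A loop. -/
noncomputable def Fragment.loop (t : SignType → Bool) (F : Fragment J) : Fragment J :=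
  have := F.finQ
  { Q := Option (Option F.Q)
    finQ := inferInstance
    start := some none
    exit := none
    control
      | none, _ => .halt
      | some none, s => .goto (if t s then some (some F.start) else none)
      | some (some i), s => if i = F.exit then .goto (some none)
          else (F.control i s).map (fun i => some (some i)) }

/-- The fragment executing a program. -/
noncomputable def Prog.fragment : Prog J → Fragment J
  | .skip => ⟨Unit, inferInstance, (), (), fun _ _ => .halt⟩
  | .act a => .act a
  | .seq p q => p.fragment.seq q.fragment
  | .ite t p q => p.fragment.branch q.fragment fun s =>
      .goto (some (if t s then .inl p.fragment.start else .inr q.fragment.start))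
  | .query p q => p.fragment.branch q.fragment fun _ =>
      .query (some (.inl p.fragment.start)) (some (.inr q.fragment.start))
  | .loop t p => .loop t p.fragment

theorem Fragment.runs_act (a : Act J) (d : Data) :
    (Fragment.act a).Runs O c d (a.run c d) :=
  .single (step_act (act a) (by simp [act]) rfl)

theorem Fragment.Runs.seq {F G : Fragment J} {d d' d'' : Data} (h : F.Runs O c d d')
    (h' : G.Runs O c d' d'') : (F.seq G).Runs O c d d'' :=
  (h.map (G := F.seq G) Sum.inl (by simp [Fragment.seq]) fun _ _ hi => if_neg hi).trans
    (.head (step_goto (F.seq G) (by simp [Fragment.seq]) (if_pos rfl))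
      (h'.map (G := F.seq G) Sum.inr (by simp [Fragment.seq]) fun _ _ _ => rfl))

theorem Fragment.Runs.branch_left {F G : Fragment J} {d d' : Data} (h : F.Runs O c d d')
    {first : SignType → Instr (Option (F.Q ⊕ G.Q)) J}
    (hs : (F.branch G first).Step O c (none, d) (some (.inl F.start), d)) :
    (F.branch G first).Runs O c d d' :=
  .head hs ((h.map (G := F.branch G first) (fun i => some (.inl i)) (by simp [Fragment.branch])
    fun _ _ hi => if_neg hi).trans
      (.single (step_goto (F.branch G first) (by simp [Fragment.branch]) (if_pos rfl))))

theorem Fragment.Runs.branch_right {F G : Fragment J} {d d' : Data} (h : G.Runs O c d d')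
    {first : SignType → Instr (Option (F.Q ⊕ G.Q)) J}
    (hs : (F.branch G first).Step O c (none, d) (some (.inr G.start), d)) :
    (F.branch G first).Runs O c d d' :=
  .head hs (h.map (G := F.branch G first) (fun i => some (.inr i)) (by simp [Fragment.branch])
    fun _ _ _ => rfl)

theorem Fragment.Runs.loop {F : Fragment J} {t : SignType → Bool} {d d' d'' : Data}
    (ht : d.test t = true) (h : F.Runs O c d d') (h' : (F.loop t).Runs O c d' d'') :
    (F.loop t).Runs O c d d'' :=
  .head (step_goto (F.loop t) (by simp [Fragment.loop]) (congrArg Instr.goto (if_pos ht)))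
    ((h.map (G := F.loop t) (fun i => some (some i)) (by simp [Fragment.loop])
      fun _ _ hi => if_neg hi).trans
        (.head (step_goto (F.loop t) (by simp [Fragment.loop]) (if_pos rfl)) h'))

/-- Correctness of compilation. `Exec` describes terminating executions only, so induction on its
derivation also covers loops. -/
theorem Exec.runs {p : Prog J} {d d' : Data} (h : Exec O c p d d') : p.fragment.Runs O c d d' := by
  induction h with
  | skip d => exact Relation.ReflTransGen.refl
  | act a d => exact Fragment.runs_act a d
  | seq _ _ ih ih' => exact ih.seq ih'
  | iteTrue ht _ ih =>
    exact ih.branch_left (Fragment.step_goto _ (by simp [Fragment.branch])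
      (congrArg (fun i => Instr.goto (some i)) (if_pos ht)))
  | iteFalse ht _ ih =>
    exact ih.branch_right (Fragment.step_goto _ (by simp [Fragment.branch])
      (congrArg (fun i => Instr.goto (some i)) (if_neg (ne_true_of_eq_false ht))))
  | queryYes ha _ ih =>
    exact ih.branch_left ((Fragment.step_query _ (by simp [Fragment.branch]) rfl).1 ha)
  | queryNo ha _ ih =>
    exact ih.branch_right ((Fragment.step_query _ (by simp [Fragment.branch]) rfl).2 ha)
  | loopTrue ht _ _ ih ih' => exact Fragment.Runs.loop ht ih ih'
  | @loopFalse t p d ht =>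
    exact .single (Fragment.step_goto (p.fragment.loop t) (q := some none) (q' := none)
      (by simp [Fragment.loop]) (congrArg Instr.goto (if_neg (ne_true_of_eq_false ht))))

/-- The data with which the execution on input `x` starts. -/
def Data.init (x : List ℝ) : Data := ⟨inputTape x, fun _ => 0, 0, 0, 0⟩

theorem Exec.outputs {p : Prog J} {x y : List ℝ} {d : Data} (h : Exec O c p (.init x) d)
    (hy : Holds d.main y) : (p.fragment.machine c).Outputs O x y := by
  refine ⟨d.config p.fragment.exit, ?_, if_pos rfl, hy⟩
  have hinit : (p.fragment.machine c).init x = (Data.init x).config p.fragment.start := by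
    refine (Config.mk.injEq ..).mpr ⟨rfl, ?_, rfl, ?_⟩ <;> funext t <;> cases t <;> rfl
  rw [hinit]
  exact Relation.ReflTransGen.lift (r := p.fragment.Step O c)
    (fun a : p.fragment.Q × Data => a.2.config a.1)
    (fun _ _ h => h) _ _ h.runs

/-- A sequence of actions. -/
def Prog.acts : List (Act J) → Prog J
  | [] => .skip
  | a :: l => .seq (.act a) (acts l)

theorem Exec.acts (l : List (Act J)) (d : Data) :
    Exec O c (.acts l) d (l.foldl (Act.run c) d) := by
  induction l generalizing d with
  | nil => exact .skip d
  | cons a l ih => exact .seq (.act a d) (ih _)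

/-- The test whether the cell under the reading head is not zero. -/
def nonzero (s : SignType) : Bool := s ≠ 0

theorem Data.test_nonzero (d : Data) : d.test nonzero = true ↔ d.main d.rd ≠ 0 := by
  simp [Data.test, nonzero]

theorem Data.test_nonzero_eq_false (d : Data) : d.test nonzero = false ↔ d.main d.rd = 0 := by
  simp [Data.test, nonzero]

theorem Holds.unique {t : ℤ → ℝ} {v w : List ℝ} (hv : Holds t v) (hw : Holds t w) : v = w := by
  have h : v.length = w.length := by exact_mod_cast hv.1.symm.trans hw.1
  refine List.ext_get h fun i h₁ h₂ => ?_
  rw [← hv.2 ⟨i, h₁⟩, ← hw.2 ⟨i, h₂⟩]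

theorem Holds.answer_iff {d : Data} {v : List ℝ} (hv : Holds d.query v) :
    d.Answer O ↔ v ∈ O :=
  ⟨fun ⟨_, hw, hw'⟩ => hv.unique hw' ▸ hw, fun h => ⟨v, h, hv⟩⟩

theorem holds_iff_getD {t : ℤ → ℝ} {v : List ℝ} :
    Holds t v ↔ t 0 = v.length ∧ ∀ k : ℕ, k < v.length → t (k + 1) = v.getD k 0 := by
  refine and_congr_right fun _ => ⟨fun h k hk => ?_, fun h i => ?_⟩
  · rw [List.getD_eq_getElem _ _ hk]; exact h ⟨k, hk⟩
  · rw [h i i.2, List.getD_eq_getElem _ _ i.2]; rfl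

/-! ### Querying the oracle about the input prefixed by constants -/

theorem exists_map_eq (l : List ℝ) (h : ∀ r ∈ l, ∃ j, c j = r) :
    ∃ js : List (Fin J), js.map c = l :=
  (Set.range_list_map c).ge h

/-- The actions preparing the query tape: write the size `n + D` of the query, then `b`. -/
def prefixActs (j : Fin J) (js : List (Fin J)) : List (Act J) :=
  -- Cell `-1` serves as scratch space for the summand `D`. It is then subtracted from itself, and
  -- its `0` later marks where the heads stop on their way back.
  [.copy .query, .moveWrite .main .left, .const .main j, .moveRead .left, .add .query, .sub .main,
    .moveRead .right, .moveWrite .main .right, .moveWrite .main .right, .moveWrite .query .right] ++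
  js.flatMap fun j => [.const .query j, .moveWrite .query .right]

/-- Copy one cell of the input to the query tape, and put `1` and a decremented counter in the
places of the old counter and of the copied cell. -/
def copyActs (one : Fin J) : List (Act J) :=
  -- The counter travels with the heads, and the trail of ones behind it keeps the return loop
  -- going.
  [.moveRead .right, .copy .query, .moveWrite .query .right, .moveRead .left, .copy .main,
    .moveWrite .main .left, .const .main one, .moveWrite .main .right, .sub .main,
    .moveRead .right, .moveWrite .main .right]

/-- Move the two heads on the main tape to the left. -/
def backActs : List (Act J) := [.moveRead .left, .moveWrite .main .left]

/-- Output the `j`-th constant; the writing head must be in cell `0`. -/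
def outputActs (one j : Fin J) : List (Act J) :=
  [.const .main one, .moveWrite .main .right, .const .main j]

/-- The program asking whether the input, prefixed with the constants `js`, is in the oracle. -/
def prefixProg (zero one j : Fin J) (js : List (Fin J)) : Prog J :=
  .seq (.acts (prefixActs j js)) <| .seq (.loop nonzero (.acts (copyActs one))) <|
    .seq (.acts backActs) <| .seq (.loop nonzero (.acts backActs)) <|
    .query (.acts (outputActs one one)) (.acts (outputActs one zero))

/-- The situation after `i` cells of the input `x` have been copied to the query tape. -/
structure Copied (b x : List ℝ) (i : ℕ) (d : Data) : Prop where
  rd : d.rd = i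
  wm : d.wm = i + 1
  wq : d.wq = b.length + i + 1
  neg : d.main (-1) = 0
  one : ∀ k : ℕ, k < i → d.main k = 1
  count : d.main i = x.length - i
  input : ∀ k : ℕ, i ≤ k → d.main (k + 1) = x.getD k 0
  size : d.query 0 = (b ++ x).length
  copy : ∀ k : ℕ, k < b.length + i → d.query (k + 1) = (b ++ x).getD k 0

theorem copied_zero {j : Fin J} {js : List (Fin J)} (hj : c j = js.length) (x : List ℝ) :
    Copied (js.map c) x 0 ((prefixActs j js).foldl (Act.run c) (.init x)) := by
  -- Here `l` is the part of the prefix already written and `is` lists the constants still to come.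
  have key : ∀ (l m : List ℝ) (is : List (Fin J)) (d : Data), l ++ is.map c = m → d.rd = 0 → d.wm = 1 →
      d.wq = l.length + 1 → d.main = inputTape x → d.query 0 = (m ++ x).length →
      (∀ k : ℕ, k < l.length → d.query (k + 1) = (m ++ x).getD k 0) →
      Copied m x 0 ((is.flatMap fun j =>
        [Act.const .query j, Act.moveWrite .query .right]).foldl (Act.run c) d) := by
    intro l m is
    induction is generalizing l with
    | nil =>
      rintro d rfl hr hw hq hm h0 hl
      simp only [List.map_nil, List.append_nil, List.flatMap_nil, List.foldl_nil] at *
      refine ⟨by simpa using hr, by simpa using hw, by simpa using hq, by simp [hm, inputTape], by simp,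
        by simp [hm, inputTape], fun k _ => ?_, by simpa using h0, by simpa using hl⟩
      rw [hm, inputTape, if_neg (by lia), if_pos (by lia)]
      simp
    | cons i is ih =>
      intro d hlm hr hw hq hm h0 hl
      rw [List.flatMap_cons, List.foldl_append]
      refine ih (l ++ [c i]) _ (by simpa using hlm) hr hw ?_ hm ?_ ?_
      · simp [Act.run, Data.write, shift, hq]
      · simp only [List.foldl, Act.run, Data.write]
        rw [Function.update_of_ne (by lia), h0]
      · intro k hk
        simp only [List.foldl, Act.run, Data.write, hq]
        rcases Nat.lt_succ_iff_lt_or_eq.1 (by simpa using hk) with hk | rfl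
        · rw [Function.update_of_ne (by lia), hl k hk]
        · rw [Function.update_self, ← hlm]
          simp
  rw [prefixActs, List.foldl_append]
  refine key [] _ js _ (by simp) ?_ ?_ ?_ ?_ ?_ (by simp)
  · simp [Data.init, Act.run, Data.write, shift]
  · simp [Data.init, Act.run, Data.write, shift]
  · simp [Data.init, Act.run, Data.write, shift]
  · simp only [List.foldl, Data.init, Act.run, Data.write, shift]
    funext k
    simp only [Function.update_apply, zero_add]
    split_ifs with hk
    · simp [hk, inputTape]
    · rfl
  · simp [Data.init, Act.run, Data.write, shift, inputTape, hj]
    ring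

theorem Copied.succ {b x : List ℝ} {i : ℕ} {d : Data} (h : Copied b x i d) {one : Fin J}
    (h1 : c one = 1) : Copied b x (i + 1) ((copyActs one).foldl (Act.run c) d) := by
  obtain ⟨m, q, rd, wm, wq⟩ := d
  obtain ⟨hr, hw, hq, hneg, hone, hcount, hinput, hsize, hcopy⟩ := h
  dsimp only at *
  subst hr hw hq
  simp only [copyActs, List.foldl, Act.run, Data.write, shift, h1]
  have e1 : (i : ℤ) + 1 + -1 = i := by ring
  simp only [e1, Function.update_self]
  refine ⟨by simp, by simp, by push_cast; ring, ?_, fun k hk => ?_, ?_, fun k hk => ?_, ?_,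
    fun k hk => ?_⟩
  · dsimp only
    rw [Function.update_of_ne (by lia), Function.update_of_ne (by lia),
      Function.update_of_ne (by lia), hneg]
  · dsimp only
    rw [Function.update_of_ne (by lia)]
    rcases Nat.lt_succ_iff_lt_or_eq.1 hk with hk | rfl
    · rw [Function.update_of_ne (by lia), Function.update_of_ne (by lia), hone k hk]
    · simp
  · simp [hcount]; ring
  · dsimp only
    rw [Function.update_of_ne (by lia), Function.update_of_ne (by lia),
      Function.update_of_ne (by lia), hinput k (by lia)]
  · dsimp only
    rw [Function.update_of_ne (by lia), hsize]
  · dsimp only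
    by_cases hk' : k = b.length + i
    · subst hk'
      rw [hinput i le_rfl, List.getD_append_right _ _ _ _ (by lia)]
      simp
    · rw [Function.update_of_ne (by lia), hcopy k (by lia)]

theorem Copied.exec_loop {b x : List ℝ} {i : ℕ} {d : Data} (h : Copied b x i d) {one : Fin J}
    (h1 : c one = 1) (hi : i ≤ x.length) :
    ∃ d', Exec O c (.loop nonzero (.acts (copyActs one))) d d' ∧ Copied b x x.length d' := by
  induction hi using Nat.decreasingInduction generalizing d with
  | self =>
    refine ⟨d, .loopFalse ?_, h⟩
    rw [Data.test_nonzero_eq_false, h.rd, h.count, sub_self]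
  | of_succ i hi ih =>
    obtain ⟨d', hd, hd'⟩ := ih (h.succ h1)
    refine ⟨d', .loopTrue ?_ (.acts _ _) hd, hd'⟩
    rw [Data.test_nonzero, h.rd, h.count, sub_ne_zero]
    exact_mod_cast hi.ne'

theorem exec_back {k : ℕ} {d : Data} (hr : d.rd = k - 1) (hw : d.wm = k) (hneg : d.main (-1) = 0)
    (hone : ∀ i : ℕ, i < k → d.main i = 1) :
    Exec O c (.loop nonzero (.acts backActs)) d { d with rd := -1, wm := 0 } := by
  induction k generalizing d with
  | zero =>
    obtain ⟨m, q, rd, wm, wq⟩ := d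
    simp only [Nat.cast_zero, zero_sub] at hr hw
    subst hr hw
    exact .loopFalse ((Data.test_nonzero_eq_false _).2 hneg)
  | succ k ih =>
    refine .loopTrue ?_ (.acts _ _) (ih (d := _) ?_ ?_ hneg fun i hi => hone i (by lia))
    · rw [Data.test_nonzero, hr, show ((k + 1 : ℕ) : ℤ) - 1 = k by lia, hone k (by lia)]
      exact one_ne_zero
    · simp [backActs, Act.run, shift, hr]; ring
    · simp [backActs, Act.run, shift, hw]

theorem holds_output {d : Data} {one j : Fin J} (h1 : c one = 1) (hw : d.wm = 0) :
    Holds ((outputActs one j).foldl (Act.run c) d).main [c j] := by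
  simp [holds_iff_getD, outputActs, Act.run, Data.write, shift, hw, h1]

theorem exec_prefixProg {zero one j : Fin J} {js : List (Fin J)} (h1 : c one = 1)
    (hj : c j = js.length) (x : List ℝ) :
    ∃ d, Exec O c (prefixProg zero one j js) (.init x) d ∧
      (js.map c ++ x ∈ O → Holds d.main [c one]) ∧ (js.map c ++ x ∉ O → Holds d.main [c zero]) := by
  obtain ⟨d, hd, h⟩ := (copied_zero hj x).exec_loop (O := O) h1 (Nat.zero_le _)
  -- The exhausted counter under the reading head is `0`, which would end the loop at once; hence
  -- one move to the left before it.
  have hback : Exec O c (.loop nonzero (.acts backActs)) (backActs.foldl (Act.run c) d)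
      { d with rd := -1, wm := 0 } :=
    exec_back (k := x.length) (by simp [backActs, Act.run, shift, h.rd]; ring)
      (by simp [backActs, Act.run, shift, h.wm]) h.neg h.one
  have hans : (Data.Answer O { d with rd := -1, wm := 0 }) ↔ js.map c ++ x ∈ O :=
    Holds.answer_iff (holds_iff_getD.2 ⟨h.size, fun k hk => h.copy k (by simpa using hk)⟩)
  by_cases hx : js.map c ++ x ∈ O
  · exact ⟨_, .seq (.acts _ _) (.seq hd (.seq (.acts _ _) (.seq hback
      (.queryYes (hans.2 hx) (.acts _ _))))), fun _ => holds_output h1 rfl, fun h => (h hx).elim⟩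
  · exact ⟨_, .seq (.acts _ _) (.seq hd (.seq (.acts _ _) (.seq hback
      (.queryNo (mt hans.1 hx) (.acts _ _))))), fun h => (hx h).elim, fun _ => holds_output h1 rfl⟩

/-- The preimage of `O` under prefixing a fixed vector is decidable relative to `O`. -/
theorem decidableRelativeTo_append {L O : Set (List ℝ)} (b : List ℝ)
    (h : ∀ x, x ∈ L ↔ b ++ x ∈ O) : DecidableRelativeTo L O := by
  let l : List ℝ := 0 :: 1 :: (b.length : ℝ) :: b
  have hc : ∀ r ∈ l, ∃ j, l.get j = r := fun r hr => List.mem_iff_get.1 hr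
  obtain ⟨zero, h0⟩ := hc 0 (by simp [l])
  obtain ⟨one, h1⟩ := hc 1 (by simp [l])
  obtain ⟨j, hj⟩ := hc b.length (by simp [l])
  obtain ⟨js, hjs⟩ := exists_map_eq b fun r hr => hc r (by simp [l, hr])
  refine ⟨(prefixProg zero one j js).fragment.machine l.get, fun x => ?_⟩
  obtain ⟨d, hd, hyes, hno⟩ := exec_prefixProg (O := O) (zero := zero) (js := js) h1
    (by rw [hj, ← hjs, List.length_map]) x
  rw [h, ← hjs]
  rw [h1] at hyes
  rw [h0] at hno
  exact ⟨fun hx => hd.outputs (hyes hx), fun hx => hd.outputs (hno hx)⟩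

theorem independents_decidableRelativeTo (z : List ℝ) :
    DecidableRelativeTo (independents z) (independents []) := by
  obtain ⟨b, hb⟩ := mem_independents_iff_append z
  exact decidableRelativeTo_append b hb

/-! ### Words of instructions that test polynomial relations -/

/-- Instructions for computing with an accumulator and a sum: multiply the accumulator by the
`i`-th parameter or by the input, add it to or subtract it from the sum (and reset it to `1`), and
stop with a given answer if the sum is zero (and reset the sum to `0` otherwise). -/
inductive Letter (D : ℕ)
  | mul (i : Fin D)
  | mulInput
  | add
  | sub
  | test (v : Bool)

/-- The list of all letters. -/
def letters (D : ℕ) : List (Letter D) :=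
  [.mulInput, .add, .sub, .test true, .test false] ++ (List.finRange D).map .mul

theorem mem_letters {D : ℕ} (a : Letter D) : a ∈ letters D := by
  rcases a with i | _ | _ | _ | (_ | _) <;> simp [letters]

open Classical in
/-- The effect of a letter on the sum and the accumulator; an error is a final answer. -/
noncomputable def Letter.run (b : List ℝ) (x : ℝ) (s : ℝ × ℝ) :
    Letter b.length → Except Bool (ℝ × ℝ)
  | .mul i => .ok (s.1, s.2 * b.get i)
  | .mulInput => .ok (s.1, s.2 * x)
  | .add => .ok (s.1 + s.2, 1)
  | .sub => .ok (s.1 - s.2, 1)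
  | .test v => if s.1 = 0 then .error v else .ok (0, s.2)

/-- The effect of a word. -/
noncomputable def runWord (b : List ℝ) (x : ℝ) (w : List (Letter b.length)) (s : ℝ × ℝ) :
    Except Bool (ℝ × ℝ) :=
  w.foldlM (Letter.run b x) s

theorem runWord_append {b : List ℝ} {x : ℝ} {w w' : List (Letter b.length)} {s s' : ℝ × ℝ}
    (h : runWord b x w s = .ok s') : runWord b x (w ++ w') s = runWord b x w' s' := by
  unfold runWord at *
  rw [List.foldlM_append, h]; rfl

/-- The functions of the input given by the input itself and by the parameters. -/
def generators (b : List ℝ) : Set (ℝ → ℝ) := insert id (Set.range fun i _ => b.get i)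

theorem exists_runWord_of_mem_submonoid {b : List ℝ} {f : ℝ → ℝ}
    (hf : f ∈ Submonoid.closure (generators b)) :
    ∃ w, ∀ x s a, runWord b x w (s, a) = .ok (s, a * f x) := by
  induction hf using Submonoid.closure_induction with
  | mem f hf =>
    rcases hf with rfl | ⟨i, rfl⟩
    · exact ⟨[.mulInput], fun _ _ _ => rfl⟩
    · exact ⟨[.mul i], fun _ _ _ => rfl⟩
  | one => exact ⟨[], fun x s a => by simp [runWord]; rfl⟩
  | mul f g _ _ ihf ihg =>
    obtain ⟨w, hw⟩ := ihf
    obtain ⟨w', hw'⟩ := ihg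
    exact ⟨w ++ w', fun x s a => by rw [runWord_append (hw x s a), hw', mul_assoc]; rfl⟩

/-- The subring is additively generated by products of generators, which the accumulator computes.
Addition and subtraction are treated together since negation exchanges them. -/
theorem exists_runWord_of_mem_subring {b : List ℝ} {f : ℝ → ℝ}
    (hf : f ∈ Subring.closure (generators b)) :
    (∃ w, ∀ x s, runWord b x w (s, 1) = .ok (s + f x, 1)) ∧
      ∃ w, ∀ x s, runWord b x w (s, 1) = .ok (s - f x, 1) := by
  rw [Subring.mem_closure_iff] at hf
  induction hf using AddSubgroup.closure_induction with
  | mem f hf =>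
    obtain ⟨w, hw⟩ := exists_runWord_of_mem_submonoid hf
    constructor
    · exact ⟨w ++ [.add], fun x s => by rw [runWord_append (hw x s 1), one_mul]; rfl⟩
    · exact ⟨w ++ [.sub], fun x s => by rw [runWord_append (hw x s 1), one_mul]; rfl⟩
  | zero => exact ⟨⟨[], fun x s => by simp [runWord]; rfl⟩, ⟨[], fun x s => by simp [runWord]; rfl⟩⟩
  | add f g _ _ ihf ihg =>
    obtain ⟨⟨w₁, h₁⟩, w₂, h₂⟩ := ihf
    obtain ⟨⟨w₃, h₃⟩, w₄, h₄⟩ := ihg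
    constructor
    · exact ⟨w₁ ++ w₃, fun x s => by rw [runWord_append (h₁ x s), h₃, Pi.add_apply, add_assoc]⟩
    · exact ⟨w₂ ++ w₄, fun x s => by rw [runWord_append (h₂ x s), h₄, Pi.add_apply, sub_sub]⟩
  | neg f _ ih =>
    obtain ⟨⟨w₁, h₁⟩, w₂, h₂⟩ := ih
    exact ⟨⟨w₂, fun x s => by rw [h₂, Pi.neg_apply, sub_eq_add_neg]⟩,
      ⟨w₁, fun x s => by rw [h₁, Pi.neg_apply, sub_neg_eq_add]⟩⟩

theorem aeval_mem_closure (b : List ℝ) (q : Polynomial ℤ) :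
    (fun x : ℝ => Polynomial.aeval x q) ∈ Subring.closure (generators b) := by
  induction q using Polynomial.induction_on' with
  | add p q hp hq =>
    simp only [map_add]
    exact add_mem hp hq
  | monomial n a =>
    have : (fun x : ℝ => Polynomial.aeval x (Polynomial.monomial n a)) =
        (a : ℝ → ℝ) * (id : ℝ → ℝ) ^ n := by
      funext x; simp [Polynomial.aeval_monomial]
    rw [this]
    exact mul_mem (intCast_mem _ a) (pow_mem (Subring.subset_closure (Set.mem_insert _ _)) n)

theorem evalAt_mem_closure (b : List ℝ) (P : MvPolynomial (Fin b.length) (Polynomial ℤ)) :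
    (fun x : ℝ => evalAt b x P) ∈ Subring.closure (generators b) := by
  induction P using MvPolynomial.induction_on with
  | C q =>
    convert aeval_mem_closure b q using 2
    simp [evalAt]
  | add p q hp hq =>
    simp only [map_add]
    exact add_mem hp hq
  | mul_X p i hp =>
    have : (fun x : ℝ => evalAt b x (p * MvPolynomial.X i)) =
        (fun x => evalAt b x p) * fun _ => b.get i := by
      funext x; simp [evalAt]
    rw [this]
    exact mul_mem hp (Subring.subset_closure (Set.mem_insert_of_mem _ ⟨i, rfl⟩))

/-- A nonempty word that never stops with a wrong answer to the question whether the input is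
transcendental, and has no other effect. -/
structure Sound (b : List ℝ) (w : List (Letter b.length)) : Prop where
  ne_nil : w ≠ []
  ok : ∀ x s, runWord b x w (0, 1) = .ok s → s = (0, 1)
  error : ∀ x v, runWord b x w (0, 1) = .error v → (v = true ↔ Transcendental ℚ x)

/-- The word first tests a nonzero coefficient of P (zero means algebraic), then P itself (zero
means transcendental). The second verdict is right only because the first test has excluded the
zeros of the coefficient. Soundness holds at every real; P is chosen so that the word stops at `x`.
-/
theorem exists_sound {b : List ℝ} (hb : AlgebraicIndependent ℤ b.get) {x : ℝ}
    (hx : ¬ AlgebraicIndependent (Algebra.adjoin ℤ (Set.range b.get)) [x].get) :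
    ∃ w, Sound b w ∧ ∃ v, runWord b x w (0, 1) = .error v := by
  obtain ⟨P, hP0, hP⟩ := exists_evalAt_eq_zero hb hx
  obtain ⟨α, hα⟩ := MvPolynomial.ne_zero_iff.1 hP0
  obtain ⟨w, hw⟩ := (exists_runWord_of_mem_subring (aeval_mem_closure b (P.coeff α))).1
  obtain ⟨w', hw'⟩ := (exists_runWord_of_mem_subring (evalAt_mem_closure b P)).1
  have key : ∀ y, runWord b y (w ++ (.test false :: (w' ++ [.test true]))) (0, 1) =
      if Polynomial.aeval y (P.coeff α) = 0 then .error false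
      else if evalAt b y P = 0 then .error true else .ok (0, 1) := by
    intro y
    rw [runWord_append (hw y 0), zero_add, runWord, List.foldlM_cons]
    split_ifs with h h'
    · simp [Letter.run, h]; rfl
    · simp only [Letter.run, h, if_false]
      refine (runWord_append (hw' y 0)).trans ?_
      simp [runWord, Letter.run, h']
    · simp only [Letter.run, h, if_false]
      refine (runWord_append (hw' y 0)).trans ?_
      simp [runWord, Letter.run, h']
  refine ⟨w ++ (.test false :: (w' ++ [.test true])),
    ⟨by simp, fun y s hs => ?_, fun y v hv => ?_⟩, ?_⟩
  · rw [key] at hs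
    split_ifs at hs
    exact (Except.ok.inj hs).symm
  · rw [key] at hv
    split_ifs at hv with h h'
    · have : IsAlgebraic ℚ y := (IsFractionRing.isAlgebraic_iff ℤ ℚ ℝ).1 ⟨_, hα, h⟩
      rw [← Except.error.inj hv]
      simpa [Transcendental] using this
    · rw [← Except.error.inj hv]
      simp only [true_iff]
      exact fun hy => evalAt_ne_zero hb hy h h'
  · simp only [key, hP, if_true]
    split_ifs <;> simp

/-! ### Encoding a sequence of words in one real number -/

theorem exists_concatenation {α : Type*} (W : ℕ → List α) (hW : ∀ k, W k ≠ []) :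
    ∃ (f : ℕ → α) (pos : ℕ → ℕ), pos 0 = 0 ∧ (∀ k, pos (k + 1) = pos k + (W k).length) ∧
      ∀ k i (hi : i < (W k).length), f (pos k + i) = (W k)[i] := by
  -- As the words are nonempty, the first `n + 1` of them already contain position `n`.
  let F : ℕ → List α := fun N => ((List.range N).map W).flatten
  have hF : ∀ N, F (N + 1) = F N ++ W N := by simp [F, List.range_succ]
  have hmono : ∀ {M N}, M ≤ N → F M <+: F N := by
    intro M N h
    induction h with
    | refl => exact List.prefix_rfl
    | step _ ih => exact ih.trans (hF _ ▸ List.prefix_append _ _)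
  have hlen : ∀ N, N ≤ (F N).length := by
    intro N
    induction N with
    | zero => simp
    | succ N ih =>
      have := List.length_pos_iff.2 (hW N)
      rw [hF, List.length_append]; lia
  refine ⟨fun n => (F (n + 1))[n]'(hlen (n + 1)), fun k => (F k).length, rfl,
    fun k => by simp [hF], fun k i hi => ?_⟩
  have h₁ : (F k).length + i < (F (k + 1)).length := by rw [hF, List.length_append]; lia
  have h₂ : F (k + 1) <+: F ((F k).length + i + 1) := hmono (by have := hlen k; lia)
  change (F ((F k).length + i + 1))[(F k).length + i]'(hlen _) = _
  rw [← h₂.getElem h₁]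
  simp [hF]

/-- Numbers in `[0, 1)` whose digits to a base larger than `m` are a given sequence. -/
theorem exists_digits {m : ℕ} (g : ℕ → Fin m) :
    ∃ R : ℕ → ℝ, ∀ n, 0 ≤ R n ∧ R n < 1 ∧ R n * (m + 1) = g n + R (n + 1) := by
  -- The top digit `m` never occurs, which makes every remainder strictly less than `1` and the
  -- integer part equal to the next digit.
  let R : ℕ → ℝ := fun n => Real.ofDigits (b := m + 1) fun j => (g (n + j)).castSucc
  have hR : ∀ n, R n * (m + 1) = g n + R (n + 1) := by
    intro n
    have := Real.ofDigits_eq_sum_add_ofDigits (fun j => (g (n + j)).castSucc) 1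
    simp only [R]
    rw [this]
    simp [Real.ofDigitsTerm]
    field_simp
    congr 2
    funext j
    congr 2
    ring
  refine ⟨R, fun n => ⟨Real.ofDigits_nonneg _, ?_, hR n⟩⟩
  have h1 : R (n + 1) ≤ 1 := Real.ofDigits_le_one _
  have h2 : ((g n : ℕ) : ℝ) + 1 ≤ m := by exact_mod_cast (g n).2
  by_contra! h
  nlinarith [hR n]

/-! ### Register programs and the interpreter for the digit stream -/

/-- The data with given tape contents in which all heads are in cell `0`. -/
def home (m q : ℤ → ℝ) : Data := ⟨m, q, 0, 0, 0⟩

theorem foldl_moveRead (n : ℕ) (δ : Turing.Dir) (d : Data) :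
    (List.replicate n (Act.moveRead δ)).foldl (Act.run c) d =
      { d with rd := d.rd + n * shift δ } := by
  induction n generalizing d with
  | zero => simp
  | succ n ih =>
    rw [List.replicate_succ, List.foldl_cons, ih]
    simp only [Act.run]
    congr 1
    push_cast; ring

theorem foldl_moveWrite (n : ℕ) (δ : Turing.Dir) (d : Data) :
    (List.replicate n (Act.moveWrite .main δ)).foldl (Act.run c) d =
      { d with wm := d.wm + n * shift δ } := by
  induction n generalizing d with
  | zero => simp
  | succ n ih =>
    rw [List.replicate_succ, List.foldl_cons, ih]
    simp only [Act.run]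
    congr 1
    push_cast; ring

/-- Move the reading head from cell `0` to cell `i` and the writing head to cell `j`, perform an
action, and move the heads back. -/
def registerActs (i j : ℕ) (a : Act J) : List (Act J) :=
  List.replicate i (.moveRead .right) ++ List.replicate j (.moveWrite .main .right) ++
    [a] ++ List.replicate i (.moveRead .left) ++ List.replicate j (.moveWrite .main .left)

/-- The program performing an action with the heads in cells `i` and `j`. -/
def register (i j : ℕ) (a : Act J) : Prog J := .acts (registerActs i j a)

theorem exec_register {i j : ℕ} {a : Act J} {m q : ℤ → ℝ} {f : ℝ → ℝ}
    (h : a.run c ⟨m, q, i, j, 0⟩ = (⟨m, q, i, j, 0⟩ : Data).write f .main) :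
    Exec O c (register i j a) (home m q) (home (Function.update m j (f (m j))) q) := by
  have : (registerActs i j a).foldl (Act.run c) (home m q) =
      home (Function.update m j (f (m j))) q := by
    simp only [registerActs, List.foldl_append, foldl_moveRead, foldl_moveWrite, home, shift,
      zero_add, mul_one, List.foldl_cons, List.foldl_nil, h, Data.write]
    simp
  exact this ▸ Exec.acts _ _

theorem exec_add {i j : ℕ} {m q : ℤ → ℝ} :
    Exec O c (register i j (.add .main)) (home m q) (home (Function.update m j (m j + m i)) q) :=
  exec_register (f := fun y => y + m i) rfl

theorem exec_mul {i j : ℕ} {m q : ℤ → ℝ} :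
    Exec O c (register i j (.mul .main)) (home m q) (home (Function.update m j (m j * m i)) q) :=
  exec_register (f := fun y => y * m i) rfl

theorem exec_sub {i j : ℕ} {m q : ℤ → ℝ} :
    Exec O c (register i j (.sub .main)) (home m q) (home (Function.update m j (m j - m i)) q) :=
  exec_register (f := fun y => y - m i) rfl

theorem exec_const {i j : ℕ} {k : Fin J} {m q : ℤ → ℝ} :
    Exec O c (register i j (.const .main k)) (home m q) (home (Function.update m j (c k)) q) :=
  exec_register (f := fun _ => c k) rfl

/-- Branch on the sign of the content of cell `i`. -/
def testCell (t : SignType → Bool) (i : ℕ) (p q : Prog J) : Prog J :=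
  .seq (.acts (List.replicate i (.moveRead .right)))
    (.ite t (.seq (.acts (List.replicate i (.moveRead .left))) p)
      (.seq (.acts (List.replicate i (.moveRead .left))) q))

theorem exec_testCell_true {t : SignType → Bool} {i : ℕ} {p₁ p₂ : Prog J} {m q : ℤ → ℝ} {d : Data}
    (ht : t (SignType.sign (m i)) = true) (h : Exec O c p₁ (home m q) d) :
    Exec O c (testCell t i p₁ p₂) (home m q) d := by
  have go := Exec.acts (O := O) (c := c) (List.replicate i (.moveRead .right)) (home m q)
  have back := Exec.acts (O := O) (c := c) (List.replicate i (.moveRead .left)) ⟨m, q, i, 0, 0⟩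
  simp only [foldl_moveRead, home, shift, zero_add, mul_one, mul_neg, add_neg_cancel] at go back
  exact .seq go (.iteTrue ht (.seq back h))

theorem exec_testCell_false {t : SignType → Bool} {i : ℕ} {p₁ p₂ : Prog J} {m q : ℤ → ℝ} {d : Data}
    (ht : t (SignType.sign (m i)) = false) (h : Exec O c p₂ (home m q) d) :
    Exec O c (testCell t i p₁ p₂) (home m q) d := by
  have go := Exec.acts (O := O) (c := c) (List.replicate i (.moveRead .right)) (home m q)
  have back := Exec.acts (O := O) (c := c) (List.replicate i (.moveRead .left)) ⟨m, q, i, 0, 0⟩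
  simp only [foldl_moveRead, home, shift, zero_add, mul_one, mul_neg, add_neg_cancel] at go back
  exact .seq go (.iteFalse ht (.seq back h))

/-- With a number `i + ρ`, `0 ≤ ρ < 1`, in cell `2`, put `ρ` in this cell and execute the `i`-th
of the given programs. -/
def dispatch (one : Fin J) : List (Prog J) → Prog J
  | [] => .skip
  | p :: ps => .seq (register 0 5 (.const .main one)) <| .seq (register 5 2 (.sub .main)) <|
      testCell (fun s => s = -1) 2 (.seq (register 5 2 (.add .main)) p) (dispatch one ps)

/-- Repeatedly subtracting `1` from `i + ρ` first gives a negative number after `i + 1` rounds,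
because `0 ≤ ρ < 1`; adding `1` back then restores `ρ`. Cell `5` is scratch. -/
theorem exec_dispatch {one : Fin J} (h1 : c one = 1) {ps : List (Prog J)} {i : ℕ}
    (hi : i < ps.length) {ρ : ℝ} (h₀ : 0 ≤ ρ) (h₁ : ρ < 1) {m q : ℤ → ℝ} (hm : m 2 = i + ρ) :
    ∃ m', (m' 0 = m 0 ∧ m' 1 = m 1 ∧ m' 2 = ρ ∧ m' 3 = m 3 ∧ m' 4 = m 4) ∧
      ∀ d, Exec O c ps[i] (home m' q) d → Exec O c (dispatch one ps) (home m q) d := by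
  induction ps generalizing i m with
  | nil => simp at hi
  | cons p ps ih =>
    set m₁ := Function.update (Function.update m 5 1) 2 (m 2 - 1) with hm₁
    have start : ∀ {d}, Exec O c (testCell (fun s => s = -1) 2
        (.seq (register 5 2 (.add .main)) p) (dispatch one ps)) (home m₁ q) d →
        Exec O c (dispatch one (p :: ps)) (home m q) d := by
      intro d hd
      refine .seq exec_const (.seq exec_sub ?_)
      simpa [h1, hm₁] using hd
    cases i with
    | zero =>
      refine ⟨Function.update m₁ 2 (m₁ 2 + m₁ 5), ?_, fun d hd =>
        start (exec_testCell_true ?_ (.seq exec_add hd))⟩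
      · simp [hm₁, hm]
      · have : m₁ 2 < 0 := by simp [hm₁, hm]; linarith
        simpa [sign_eq_neg_one_iff] using this
    | succ i =>
      obtain ⟨m', hm', h⟩ := ih (i := i) (m := m₁) (by simpa using hi)
        (by simp [hm₁, hm]; ring)
      refine ⟨m', by simpa [hm₁] using hm', fun d hd => start (exec_testCell_false ?_ (h d hd))⟩
      have : 0 ≤ m₁ 2 := by
        have := Nat.cast_nonneg (α := ℝ) i
        simp [hm₁, hm]
        linarith
      simpa [sign_eq_neg_one_iff] using this

/-- The contents of the registers: a flag, the input, the remaining stream of digits, the sum and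
the accumulator. -/
structure Registers (x r : ℝ) (s : ℝ × ℝ) (m : ℤ → ℝ) : Prop where
  flag : m 0 = 0
  input : m 1 = x
  stream : m 2 = r
  sum : m 3 = s.1
  acc : m 4 = s.2

/-- The program executing a letter. -/
def Letter.prog {D : ℕ} (zero one : Fin J) (param : Fin D → Fin J) : Letter D → Prog J
  | .mul i => .seq (register 0 5 (.const .main (param i))) (register 5 4 (.mul .main))
  | .mulInput => register 1 4 (.mul .main)
  | .add => .seq (register 4 3 (.add .main)) (register 0 4 (.const .main one))
  | .sub => .seq (register 4 3 (.sub .main)) (register 0 4 (.const .main one))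
  | .test v => testCell nonzero 3 (register 3 3 (.sub .main))
      (.seq (register 0 1 (.const .main (if v then one else zero)))
        (register 0 0 (.const .main one)))

/-- The flag is set, and the answer is in cell `1`. -/
def Answered (v : Bool) (m : ℤ → ℝ) : Prop := m 0 = 1 ∧ m 1 = if v then 1 else 0

section

variable {b : List ℝ} {zero one base : Fin J} {param : Fin b.length → Fin J}
  (h0 : c zero = 0) (h1 : c one = 1) (hb : ∀ i, c (param i) = b.get i)

include h0 h1 hb in
theorem Letter.exec_prog (a : Letter b.length) {x r : ℝ} {s : ℝ × ℝ} {m : ℤ → ℝ}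
    (hm : Registers x r s m) (q : ℤ → ℝ) :
    ∃ m', Exec O c (a.prog zero one param) (home m q) (home m' q) ∧
      (∀ s', a.run b x s = .ok s' → Registers x r s' m') ∧
      ∀ v, a.run b x s = .error v → Answered v m' := by
  obtain ⟨hf, hx, hr, hs, ha⟩ := hm
  obtain ⟨s, A⟩ := s
  dsimp only at hs ha
  cases a with
  | mul i =>
    refine ⟨_, .seq exec_const exec_mul, fun s' h => ?_, by simp [Letter.run]⟩
    obtain rfl := Except.ok.inj h
    constructor <;> simp [*]
  | mulInput =>
    refine ⟨_, exec_mul, fun s' h => ?_, by simp [Letter.run]⟩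
    obtain rfl := Except.ok.inj h
    constructor <;> simp [*]
  | add =>
    refine ⟨_, .seq exec_add exec_const, fun s' h => ?_, by simp [Letter.run]⟩
    obtain rfl := Except.ok.inj h
    constructor <;> simp [*]
  | sub =>
    refine ⟨_, .seq exec_sub exec_const, fun s' h => ?_, by simp [Letter.run]⟩
    obtain rfl := Except.ok.inj h
    constructor <;> simp [*]
  | test v =>
    by_cases h : s = 0
    · refine ⟨_, exec_testCell_false (by simp [nonzero, hs, h]) (.seq exec_const exec_const), ?_, ?_⟩
      · simp [Letter.run, h]
      · intro v' hv
        simp only [Letter.run, h, if_true] at hv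
        obtain rfl := Except.error.inj hv
        cases v <;> simp [Answered, h0, h1]
    · refine ⟨_, exec_testCell_true (by simp [nonzero, hs, h]) exec_sub, fun s' hs' => ?_, ?_⟩
      · simp only [Letter.run, h, if_false] at hs'
        obtain rfl := Except.ok.inj hs'
        constructor <;> simp [*]
      · simp [Letter.run, h]

/-- Read the next letter from the stream and execute it. -/
def stepProg {D : ℕ} (zero one base : Fin J) (param : Fin D → Fin J) : Prog J :=
  .seq (register 0 5 (.const .main base)) <| .seq (register 5 2 (.mul .main)) <|
    dispatch one ((letters D).map (Letter.prog zero one param))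

/-- Execute letters from the stream until the flag is set. -/
def streamProg {D : ℕ} (zero one base : Fin J) (param : Fin D → Fin J) : Prog J :=
  .loop (fun s => s = 0) (stepProg zero one base param)

variable (O c zero one base param) in
/-- From these register contents, executing the stream leads to the answer `v`. -/
def Leads (x r : ℝ) (s : ℝ × ℝ) (v : Bool) : Prop :=
  ∀ m q, Registers x r s m → ∃ m', Exec O c (streamProg zero one base param) (home m q) (home m' q) ∧
    Answered v m'

include h0 h1 hb in
-- One round of the interpreter: multiplying by the base brings the next digit into the integer
-- part. A continuing letter defers to the remaining stream; a stopping one sets the flag and ends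
-- the loop.
theorem Leads.head (hbase : c base = (letters b.length).length + 1) {x r r' : ℝ} {s : ℝ × ℝ}
    {v : Bool} {g : Fin (letters b.length).length} (h₀ : 0 ≤ r') (h₁ : r' < 1)
    (hr : r * ((letters b.length).length + 1) = g + r')
    (hok : ∀ s', ((letters b.length).get g).run b x s = .ok s' →
      Leads O c zero one base param x r' s' v)
    (herr : ∀ v', ((letters b.length).get g).run b x s = .error v' → v' = v) :
    Leads O c zero one base param x r s v := by
  intro m q hm
  set m₁ := Function.update (Function.update m 5 (c base)) 2 (m 2 * c base) with hm₁
  have hm₁2 : m₁ 2 = (g : ℕ) + r' := by simp [hm₁, hbase, hm.stream, hr]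
  obtain ⟨m₂, hm₂, hdisp⟩ := exec_dispatch (O := O) h1
    (ps := (letters b.length).map (Letter.prog zero one param)) (i := g) (by simp) h₀ h₁ (q := q) hm₁2
  have hreg : Registers x r' s m₂ := by
    obtain ⟨e0, e1, e2, e3, e4⟩ := hm₂
    obtain ⟨hf, hx, hr, hs, ha⟩ := hm
    constructor <;> simp [*]
  obtain ⟨m₃, hexec, hok', herr'⟩ :=
    Letter.exec_prog (O := O) h0 h1 hb ((letters b.length).get g) hreg q
  have hstep : Exec O c (stepProg zero one base param) (home m q) (home m₃ q) := by
    refine .seq exec_const (.seq exec_mul ?_)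
    have := hdisp _ (by simpa using hexec)
    simpa [hm₁] using this
  have htest : (home m q).test (fun s => s = 0) = true := by
    simp [Data.test, home, hm.flag]
  cases hrun : ((letters b.length).get g).run b x s with
  | ok s' =>
    obtain ⟨m', hm', hans⟩ := hok s' hrun m₃ q (hok' s' hrun)
    exact ⟨m', .loopTrue htest hstep hm', hans⟩
  | error v' =>
    obtain rfl := herr v' hrun
    have hans := herr' v' hrun
    exact ⟨m₃, .loopTrue htest hstep (.loopFalse (by simp [Data.test, home, hans.1])), hans⟩

include h0 h1 hb in
theorem Leads.word (hbase : c base = (letters b.length).length + 1)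
    {g : ℕ → Fin (letters b.length).length} {R : ℕ → ℝ}
    (hR : ∀ n, 0 ≤ R n ∧ R n < 1 ∧ R n * ((letters b.length).length + 1) = g n + R (n + 1))
    {x : ℝ} {v : Bool} (w : List (Letter b.length)) (n : ℕ)
    (hw : ∀ i (hi : i < w.length), (letters b.length).get (g (n + i)) = w[i]) (s : ℝ × ℝ)
    (hok : ∀ s', runWord b x w s = .ok s' → Leads O c zero one base param x (R (n + w.length)) s' v)
    (herr : ∀ v', runWord b x w s = .error v' → v' = v) :
    Leads O c zero one base param x (R n) s v := by
  induction w generalizing n s with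
  | nil => exact hok s rfl
  | cons a w ih =>
    have ha : (letters b.length).get (g n) = a := hw 0 (by simp)
    refine Leads.head h0 h1 hb hbase (hR (n + 1)).1 (hR (n + 1)).2.1 (hR n).2.2 ?_ ?_
    · intro s' hs'
      rw [ha] at hs'
      have hrun : runWord b x (a :: w) s = runWord b x w s' := by
        simp only [runWord, List.foldlM_cons, hs']; rfl
      refine ih (n + 1) (fun i hi => ?_) s' (fun s'' hs'' => ?_) fun v' hv' => ?_
      · rw [show n + 1 + i = n + (i + 1) by lia]
        exact hw (i + 1) (by simpa using hi)
      · rw [add_assoc, add_comm 1]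
        exact hok s'' (hrun.trans hs'')
      · exact herr v' (hrun.trans hv')
    · intro v' hv'
      rw [ha] at hv'
      exact herr v' (by simp only [runWord, List.foldlM_cons, hv']; rfl)

end

/-! ### Deciding transcendence -/

/-- Some stream of letters decides the transcendence of all numbers that are algebraic over the
field generated by `b`. -/
theorem exists_stream {b : List ℝ} (hbi : AlgebraicIndependent ℤ b.get) :
    ∃ r : ℝ, ∀ (J : ℕ) (c : Fin J → ℝ) (O : Set (List ℝ)) (zero one base : Fin J)
      (param : Fin b.length → Fin J), c zero = 0 → c one = 1 →
      c base = (letters b.length).length + 1 → (∀ i, c (param i) = b.get i) → ∀ (x : ℝ) (v : Bool),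
      (v = true ↔ Transcendental ℚ x) →
      ¬ AlgebraicIndependent (Algebra.adjoin ℤ (Set.range b.get)) [x].get →
      Leads O c zero one base param x r (0, 1) v := by
  have hcount : Countable (Letter b.length) := by
    refine Function.Surjective.countable (f := (letters b.length).get) fun a => ?_
    exact List.mem_iff_get.1 (mem_letters a)
  have hne : Nonempty {w // Sound b w} := by
    -- A harmless word, testing whether `-1` is zero; it is needed only so that the sound words can
    -- be enumerated by ℕ.
    have hrun : ∀ x, runWord b x [.sub, .test true] (0, 1) = .ok (0, 1) := fun x => by
      simp [runWord, Letter.run, bind, Except.bind]; rfl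
    refine ⟨[.sub, .test true], by simp, fun x s h => ?_, fun x v h => ?_⟩
    · rw [hrun] at h; exact (Except.ok.inj h).symm
    · rw [hrun] at h; cases h
  -- The enumeration need not be effective, since it enters the machine as a real constant.
  obtain ⟨W, hW⟩ := exists_surjective_nat {w // Sound b w}
  obtain ⟨f, pos, hpos0, hpos, hf⟩ := exists_concatenation (fun k => (W k).1)
    fun k => (W k).2.ne_nil
  choose g hg using fun n => List.mem_iff_get.1 (mem_letters (f n))
  obtain ⟨R, hR⟩ := exists_digits g
  refine ⟨R (pos 0), fun J c O zero one base param h0 h1 hbase hb x v hv hx => ?_⟩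
  obtain ⟨w, hw, v', hrun⟩ := exists_sound hbi hx
  obtain ⟨K, hK⟩ := hW ⟨w, hw⟩
  have bool_eq : ∀ v' : Bool, (v' = true ↔ Transcendental ℚ x) → v' = v := fun v' h =>
    Bool.eq_iff_iff.2 (h.trans hv.symm)
  have hblock : ∀ k i (hi : i < (W k).1.length),
      (letters b.length).get (g (pos k + i)) = (W k).1[i] := fun k i hi => by
    rw [hg, hf]
  -- Word `K` certainly stops at `x`. Each earlier word either stops with the right answer or
  -- restores `(0, 1)`, so the claim descends from `K` to `0`.
  suffices ∀ k, k ≤ K → Leads O c zero one base param x (R (pos k)) (0, 1) v from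
    this 0 K.zero_le
  intro k hk
  induction hk using Nat.decreasingInduction with
  | self =>
    refine Leads.word h0 h1 hb hbase hR (W K).1 (pos K) (hblock K) _ (fun s' hs' => ?_)
      fun v' hv' => bool_eq v' ((W K).2.error x v' hv')
    rw [hK, hrun] at hs'
    cases hs'
  | of_succ k _ ih =>
    refine Leads.word h0 h1 hb hbase hR (W k).1 (pos k) (hblock k) _ (fun s' hs' => ?_)
      fun v' hv' => bool_eq v' ((W k).2.error x v' hv')
    rw [(W k).2.ok x s' hs', ← hpos]
    exact ih

/-- Write `(1, x)` to the query tape, where `x` is the content of cell `1`. -/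
def queryActs (one : Fin J) : List (Act J) :=
  [.const .query one, .moveWrite .query .right, .moveRead .right, .copy .query, .moveRead .left,
    .moveWrite .query .left]

/-- Decide whether the input is a single transcendental number. -/
def transcendenceProg {D : ℕ} (zero one base stream : Fin J) (param : Fin D → Fin J) : Prog J :=
  -- Cell `5` receives `1 - n`, which is nonzero exactly for inputs of the wrong size; these are
  -- rejected.
  .seq (register 0 5 (.const .main one)) <| .seq (register 0 5 (.sub .main)) <|
    testCell nonzero 5
      (.seq (register 0 1 (.const .main zero)) (register 0 0 (.const .main one))) <|
    .seq (.acts (queryActs one)) <|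
    -- Cell `0` still holds the input size `1`, which is also the output size, so only the answer is
    -- written. Otherwise cell `0` is cleared to act as the flag, whose final value `1` is again the
    -- output size.
    .query (register 0 1 (.const .main one)) <|
    .seq (register 0 0 (.const .main zero)) <| .seq (register 0 2 (.const .main stream)) <|
    .seq (register 0 3 (.const .main zero)) <| .seq (register 0 4 (.const .main one)) <|
    streamProg zero one base param

theorem holds_singleton_iff {t : ℤ → ℝ} {y : ℝ} : Holds t [y] ↔ t 0 = 1 ∧ t 1 = y := by
  simp [holds_iff_getD]

theorem exec_queryActs {one : Fin J} (h1 : c one = 1) {m : ℤ → ℝ} :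
    ∃ q, Exec O c (.acts (queryActs one)) (home m fun _ => 0) (home m q) ∧ Holds q [m 1] := by
  refine ⟨Function.update (Function.update (fun _ => 0) 0 1) 1 (m 1), ?_, ?_⟩
  · have : (queryActs one).foldl (Act.run c) (home m fun _ => 0) =
        home m (Function.update (Function.update (fun _ => 0) 0 1) 1 (m 1)) := by
      simp [queryActs, Act.run, Data.write, home, shift, h1]
    exact this ▸ Exec.acts _ _
  · simp [holds_singleton_iff]

open Classical in
theorem exec_transcendenceProg {z b : List ℝ} {zero one base stream : Fin J}
    {param : Fin b.length → Fin J} (h0 : c zero = 0) (h1 : c one = 1)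
    (hstream : ∀ (x : ℝ) (v : Bool), (v = true ↔ Transcendental ℚ x) → [x] ∉ independents z →
      Leads (independents z) c zero one base param x (c stream) (0, 1) v) (x : List ℝ) :
    ∃ m q, Exec (independents z) c (transcendenceProg zero one base stream param)
      (.init x) (home m q) ∧ m 0 = 1 ∧ m 1 = if x ∈ transcendentals then 1 else 0 := by
  by_cases hlen : x.length = 1
  · obtain ⟨x, rfl⟩ := List.length_eq_one_iff.1 hlen
    have hx : [x] ∈ transcendentals ↔ Transcendental ℚ x :=
      ⟨fun ⟨y, hy, hy'⟩ => by rwa [(List.cons.inj hy).1], fun h => ⟨x, rfl, h⟩⟩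
    obtain ⟨m, hm, hm0, hm1, hm5⟩ : ∃ m : ℤ → ℝ, (∀ p d, Exec (independents z) c p
        (home m fun _ => 0) d → Exec (independents z) c (.seq (register 0 5 (.const .main one))
          (.seq (register 0 5 (.sub .main)) p)) (.init [x]) d) ∧ m 0 = 1 ∧ m 1 = x ∧ m 5 = 0 :=
      ⟨_, fun p d hd => .seq exec_const (.seq exec_sub hd), by simp [inputTape],
        by simp [inputTape], by simp [inputTape, h1]⟩
    obtain ⟨q, hq, hholds⟩ := exec_queryActs (O := independents z) h1 (m := m)
    rw [hm1] at hholds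
    by_cases hxi : [x] ∈ independents z
    · refine ⟨_, q, hm _ _ (exec_testCell_false (by simp [nonzero, hm5]) (.seq hq
        (.queryYes ?_ exec_const))), by simp [hm0], ?_⟩
      · exact (Holds.answer_iff (d := home m q) hholds).2 hxi
      · have : Transcendental ℚ x := by
          have h := (algebraicIndependent_unique_type_iff (ι := Fin 1)).1 hxi
          exact h.restrictScalars (algebraMap ℚ _).injective
        simp [hx, this, h1]
    · obtain ⟨m', hm', hans⟩ := hstream x (decide (Transcendental ℚ x)) (by simp) hxi
        (Function.update (Function.update (Function.update (Function.update m 0 (c zero))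
          2 (c stream)) 3 (c zero)) 4 (c one)) q
        (by constructor <;> simp [h0, h1, hm1])
      refine ⟨m', q, hm _ _ (exec_testCell_false (by simp [nonzero, hm5]) (.seq hq
        (.queryNo ?_ (.seq exec_const (.seq exec_const (.seq exec_const
          (.seq exec_const hm'))))))), hans.1, ?_⟩
      · exact mt (Holds.answer_iff (d := home m q) hholds).1 hxi
      · simpa [hx] using hans.2
  · have hx : x ∉ transcendentals := by
      rintro ⟨y, rfl, -⟩
      exact hlen rfl
    have hlen' : (1 : ℝ) - x.length ≠ 0 := by
      rw [sub_ne_zero]; exact_mod_cast Ne.symm hlen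
    refine ⟨_, _, .seq exec_const (.seq exec_sub
      (exec_testCell_true ?_ (.seq exec_const exec_const))), ?_, ?_⟩
    · simpa [nonzero, inputTape, h1] using hlen'
    · simp [h1]
    · simp [h0, hx]

theorem transcendentals_decidableRelativeTo (z : List ℝ) :
    DecidableRelativeTo transcendentals (independents z) := by
  obtain ⟨b, hbi, -, hz⟩ := mem_independents_iff z
  obtain ⟨r, hr⟩ := exists_stream hbi
  let l : List ℝ := 0 :: 1 :: ((letters b.length).length + 1 : ℝ) :: r :: b
  have hc : ∀ y ∈ l, ∃ j, l.get j = y := fun y hy => List.mem_iff_get.1 hy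
  obtain ⟨zero, h0⟩ := hc 0 (by simp [l])
  obtain ⟨one, h1⟩ := hc 1 (by simp [l])
  obtain ⟨base, hbase⟩ := hc ((letters b.length).length + 1) (by simp [l])
  obtain ⟨stream, hstream⟩ := hc r (by simp [l])
  choose param hb using fun i => hc (b.get i) (by simp [l])
  refine ⟨(transcendenceProg zero one base stream param).fragment.machine l.get, fun x => ?_⟩
  obtain ⟨m, q, h, hm0, hm1⟩ := exec_transcendenceProg (z := z) (base := base) (stream := stream)
    (param := param) h0 h1 (fun x v hv hx => by
      rw [hstream]
      exact hr _ _ _ _ _ _ _ h0 h1 hbase hb x v hv (mt (hz [x]).2 hx)) x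
  constructor <;> intro hx
  · rw [if_pos hx] at hm1
    exact h.outputs (holds_singleton_iff.2 ⟨hm0, hm1⟩)
  · rw [if_neg hx] at hm1
    exact h.outputs (holds_singleton_iff.2 ⟨hm0, hm1⟩)

end BSS

theorem mainTheorem9 (z : List ℝ) :
    BSS.DecidableRelativeTo BSS.transcendentals (BSS.independents z) ∧
      BSS.DecidableRelativeTo (BSS.independents z) (BSS.independents []) :=
  ⟨BSS.transcendentals_decidableRelativeTo z, BSS.independents_decidableRelativeTo z⟩
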